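/- A topological dynamical system (t.d.s.) is a pair $(X,T)$ of a compact metric space $X$ and a continuous surjective map $T:X\to X$. It is transitive if $\{n\ge 0: T^{-n}V\cap U\ne\emptyset\}$ is infinite for all non-empty open $U,V\subset X$; weakly mixing if $(X\times X,T\times T)$ is transitive; minimal if every forward orbit $\{x,Tx,T^2x,\dots\}$ is dense in $X$. A point $x$ is distal if the only point $y$ of the closure of its forward orbit with $\liminf_{n\to\infty}d(T^nx,T^ny)=0$ is $y=x$. Let $K(X)$ be the space of non-empty closed subsets of $X$ with the Hausdorff metric, and $T_K:K(X)\to K(X)$, $T_K(C)=T(C)$. The system $(X,T)$ has dense distal sets if for every non-empty open $U\subset X$ there is a distal point $C$ of $(K(X),T_K)$ with $C\subset U$. Two t.d.s. $(X,T)$ and $(Y,S)$ are disjoint if $X\times Y$ is the only joining, a joining being a non-empty closed set $J\subset X\times Y$ with $(T\times S)(J)\subset J$ whose projections to $X$ and to $Y$ are onto. Theorem. If a t.d.s. $(X,T)$ is weakly mixing and has dense distal sets, then it is disjoint from every minimal t.d.s. $(Y,S)$. -/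

import Mathlib

open Set Filter Topology TopologicalSpace

namespace TopDyn

/-- The set `N(U, V)` of those `n ≥ 0` for which `T⁻ⁿ V ∩ U` is non-empty. -/
def hittingTimes {X : Type*} (T : X → X) (U V : Set X) : Set ℕ :=
  {n : ℕ | ((T^[n]) ⁻¹' V ∩ U).Nonempty}

/-- Topological transitivity: `N(U, V)` is infinite for all non-empty open sets `U`, `V`. -/
def IsTransitive {X : Type*} [TopologicalSpace X] (T : X → X) : Prop :=
  ∀ U V : Set X, IsOpen U → U.Nonempty → IsOpen V → V.Nonempty → (hittingTimes T U V).Infinite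

/-- Weak mixing: the product system `(X × X, T × T)` is transitive. -/
def IsWeaklyMixing {X : Type*} [TopologicalSpace X] (T : X → X) : Prop :=
  IsTransitive (Prod.map T T)

/-- The forward orbit `{x, T x, T² x, …}`. -/
def orbit {X : Type*} (T : X → X) (x : X) : Set X :=
  Set.range fun n : ℕ => T^[n] x

/-- Minimality: every point is a transitive point, i.e. has a dense forward orbit. -/
def IsMinimal {X : Type*} [TopologicalSpace X] (T : X → X) : Prop :=
  ∀ x : X, Dense (orbit T x)

/-- A pair of points is proximal if `liminf d(Tⁿ x, Tⁿ y) = 0`. (In a bounded space, in particular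
in a compact one, the real-valued `liminf` is the genuine one.) -/
def IsProximalPair {X : Type*} [MetricSpace X] (T : X → X) (x y : X) : Prop :=
  liminf (fun n : ℕ => dist (T^[n] x) (T^[n] y)) atTop = 0

/-- A point is distal if it is proximal to no other point of its orbit closure. -/
def IsDistalPoint {X : Type*} [MetricSpace X] (T : X → X) (x : X) : Prop :=
  ∀ y ∈ closure (orbit T x), IsProximalPair T x y → x = y

/-- The map `C ↦ T C` induced on the hyperspace. For a compact metric space `X`, the type
`NonemptyCompacts X` is the space of non-empty closed subsets of `X`, and Mathlib's metric on it
is the Hausdorff metric. -/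
def hyperMap {X : Type*} [MetricSpace X] (T : X → X) (hT : Continuous T) :
    NonemptyCompacts X → NonemptyCompacts X :=
  NonemptyCompacts.map T hT

/-- Dense distal sets: every non-empty open subset of `X` contains, as a subset, a distal point of
the hyperspace system. -/
def HasDenseDistalSets {X : Type*} [MetricSpace X] (T : X → X) (hT : Continuous T) : Prop :=
  ∀ U : Set X, IsOpen U → U.Nonempty →
    ∃ C : NonemptyCompacts X, IsDistalPoint (hyperMap T hT) C ∧ (C : Set X) ⊆ U

/-- A joining: a non-empty closed invariant subset of `X × Y` that projects onto `X` and
onto `Y`. -/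
structure IsJoining {X Y : Type*} [TopologicalSpace X] [TopologicalSpace Y]
    (T : X → X) (S : Y → Y) (J : Set (X × Y)) : Prop where
  nonempty : J.Nonempty
  isClosed : IsClosed J
  invariant : Prod.map T S '' J ⊆ J
  fst_image : Prod.fst '' J = Set.univ
  snd_image : Prod.snd '' J = Set.univ

/-- Two systems are disjoint if `X × Y` is their only joining. -/
def AreDisjoint {X Y : Type*} [TopologicalSpace X] [TopologicalSpace Y]
    (T : X → X) (S : Y → Y) : Prop :=
  ∀ J : Set (X × Y), IsJoining T S J → J = Set.univ

end TopDyn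

/-! Pick a distal set `C` in each basic open set and a point `c ∈ C`. Weak mixing and Baire category
give one `x₀` that, for every such `c`, every `L` and every tolerance, follows the orbit of `c` in
step with it along some block of `L + 1` times (`dense_shadowing`). For `y` in a minimal system,
distality puts `(C, y)` in a minimal set (`IsDistalPoint.exists_minimal_mem`), so it returns near
itself with bounded gaps, hence during a block. At that time `x₀` is near a point of `C` and `y` is
near `y`. The orbit closure of `(x₀, y)` thus contains `X × {y}`. A joining meets the fibre over
`x₀`, so it contains some `X × {y}`, then its images, then everything. -/

namespace TopDyn

/-! ### Simultaneous hitting times -/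

section Transitivity

variable {X : Type*} [TopologicalSpace X] {T : X → X}

/-- Furstenberg's intersection lemma for two pairs of open sets. -/
theorem IsWeaklyMixing.exists_hittingTimes_subset_inter (hT : Continuous T)
    (hmix : IsWeaklyMixing T) {A B C D : Set X}
    (hA : IsOpen A) (hA' : A.Nonempty) (hB : IsOpen B) (hB' : B.Nonempty)
    (hC : IsOpen C) (hC' : C.Nonempty) (hD : IsOpen D) (hD' : D.Nonempty) :
    ∃ U V : Set X, IsOpen U ∧ U.Nonempty ∧ IsOpen V ∧ V.Nonempty ∧
      hittingTimes T U V ⊆ hittingTimes T A B ∩ hittingTimes T C D := by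
  obtain ⟨n, ⟨p, q⟩, hpC, hpA⟩ := (hmix (A ×ˢ B) (C ×ˢ D) (hA.prod hB) (hA'.prod hB')
    (hC.prod hD) (hC'.prod hD')).nonempty
  rw [Set.mem_preimage, Prod.map_iterate] at hpC
  refine ⟨A ∩ T^[n] ⁻¹' C, B ∩ T^[n] ⁻¹' D, hA.inter (hC.preimage (hT.iterate n)),
    ⟨p, hpA.1, hpC.1⟩, hB.inter (hD.preimage (hT.iterate n)), ⟨q, hpA.2, hpC.2⟩, ?_⟩
  rintro k ⟨x, ⟨hxB, hxD⟩, hxA, hxC⟩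
  refine ⟨⟨x, hxB, hxA⟩, T^[n] x, ?_, hxC⟩
  rw [Set.mem_preimage, ← Function.iterate_add_apply] at hxD ⊢
  rwa [Nat.add_comm]

/-- Furstenberg's intersection lemma for finitely many target sets. -/
theorem IsWeaklyMixing.exists_hittingTimes_subset (hT : Continuous T)
    (hmix : IsWeaklyMixing T) {ι : Type*} (s : Finset ι) {O : Set X} (hO : IsOpen O)
    (hO' : O.Nonempty) (V : ι → Set X) (hV : ∀ i, IsOpen (V i)) (hV' : ∀ i, (V i).Nonempty) :
    ∃ U W : Set X, IsOpen U ∧ U.Nonempty ∧ IsOpen W ∧ W.Nonempty ∧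
      ∀ i ∈ s, hittingTimes T U W ⊆ hittingTimes T O (V i) := by
  classical
  induction s using Finset.induction_on with
  | empty => exact ⟨O, O, hO, hO', hO, hO', by simp⟩
  | insert i s _ ih =>
    obtain ⟨U, W, hU, hU', hW, hW', h⟩ := ih
    obtain ⟨U₁, W₁, hU₁, hU₁', hW₁, hW₁', h₁⟩ :=
      hmix.exists_hittingTimes_subset_inter hT hU hU' hW hW' hO hO' (hV i) (hV' i)
    refine ⟨U₁, W₁, hU₁, hU₁', hW₁, hW₁', fun j hj => ?_⟩
    rcases Finset.mem_insert.1 hj with rfl | hj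
    · exact h₁.trans Set.inter_subset_right
    · exact (h₁.trans Set.inter_subset_left).trans (h j hj)

theorem IsWeaklyMixing.exists_mem_hittingTimes (hT : Continuous T)
    (hmix : IsWeaklyMixing T) {ι : Type*} (s : Finset ι) {O : Set X} (hO : IsOpen O)
    (hO' : O.Nonempty) (V : ι → Set X) (hV : ∀ i, IsOpen (V i)) (hV' : ∀ i, (V i).Nonempty) :
    ∃ n, ∀ i ∈ s, n ∈ hittingTimes T O (V i) := by
  obtain ⟨U, W, hU, hU', hW, hW', h⟩ := hmix.exists_hittingTimes_subset hT s hO hO' V hV hV'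
  obtain ⟨n, ⟨p, q⟩, hp, hq⟩ := (hmix (U ×ˢ U) (W ×ˢ W) (hU.prod hU) (hU'.prod hU')
    (hW.prod hW) (hW'.prod hW')).nonempty
  rw [Set.mem_preimage, Prod.map_iterate] at hp
  exact ⟨n, fun i hi => h i hi ⟨p, hp.1, hq.1⟩⟩

end Transitivity

/-! ### Shadowing a given orbit along long blocks -/

section Shadowing

variable {X : Type*} [MetricSpace X] {T : X → X}

/-- The points that stay `ε`-close to `c` along some block of `L + 1` consecutive times. -/
def shadowing (T : X → X) (c : X) (L : ℕ) (ε : ℝ) : Set X :=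
  ⋃ a : ℕ, ⋂ n ∈ Finset.range (L + 1), {x | dist (T^[n + a] x) (T^[n + a] c) < ε}

theorem isOpen_shadowing (hT : Continuous T) (c : X) (L : ℕ) (ε : ℝ) :
    IsOpen (shadowing T c L ε) :=
  isOpen_iUnion fun a => isOpen_biInter_finset fun n _ =>
    isOpen_lt ((hT.iterate (n + a)).dist continuous_const) continuous_const

theorem exists_pos_forall_dist_iterate_lt [CompactSpace X] (hT : Continuous T) (L : ℕ) {ε : ℝ}
    (hε : 0 < ε) : ∃ δ > 0, ∀ p q : X, dist p q < δ →
      ∀ n ∈ Finset.range (L + 1), dist (T^[n] p) (T^[n] q) < ε := by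
  have h : ∀ᶠ pq : X × X in uniformity X,
      ∀ n ∈ Finset.range (L + 1), dist (T^[n] pq.1) (T^[n] pq.2) < ε := by
    rw [Filter.eventually_all_finset]
    intro n _
    exact CompactSpace.uniformContinuous_of_continuous (hT.iterate n) (Metric.dist_mem_uniformity hε)
  obtain ⟨δ, hδ, h⟩ := Metric.mem_uniformity_dist.1 h
  exact ⟨δ, hδ, fun p q hpq => h hpq⟩

/-- The ball containing `T^[a] c` depends on `a`, so `a` is chosen to make `O` hit every ball of a
finite `δ / 2`-net at once; uniform continuity extends closeness at time `a` to the block. -/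
theorem IsWeaklyMixing.dense_shadowing [CompactSpace X] (hT : Continuous T)
    (hmix : IsWeaklyMixing T) (c : X) (L : ℕ) {ε : ℝ} (hε : 0 < ε) :
    Dense (shadowing T c L ε) := by
  rw [dense_iff_inter_open]
  intro O hO hO'
  obtain ⟨δ, hδ, h⟩ := exists_pos_forall_dist_iterate_lt hT L hε
  obtain ⟨t, _, ht, hcover⟩ := finite_cover_balls_of_compact (isCompact_univ (X := X))
    (half_pos hδ)
  obtain ⟨a, ha⟩ := hmix.exists_mem_hittingTimes hT ht.toFinset hO hO'
    (fun z => Metric.ball z (δ / 2)) (fun _ => Metric.isOpen_ball)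
    (fun z => ⟨z, Metric.mem_ball_self (half_pos hδ)⟩)
  obtain ⟨z, hz, hcz⟩ := Set.mem_iUnion₂.1 (hcover (Set.mem_univ (T^[a] c)))
  obtain ⟨x, hxz, hxO⟩ := ha z (ht.mem_toFinset.2 hz)
  refine ⟨x, hxO, Set.mem_iUnion.2 ⟨a, Set.mem_iInter₂.2 fun n hn => ?_⟩⟩
  rw [Set.mem_ofPred_eq, Function.iterate_add_apply, Function.iterate_add_apply]
  refine h _ _ ((dist_triangle_right _ _ z).trans_lt ?_) n hn
  have h1 : dist (T^[a] x) z < δ / 2 := hxz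
  have h2 : dist (T^[a] c) z < δ / 2 := hcz
  linarith

end Shadowing

/-! ### Enveloping semigroup and minimal sets -/

section EnvelopingSemigroup

variable {Z : Type*} [TopologicalSpace Z] {f : Z → Z}

/-- The Ellis–Numakura lemma for semigroups of self-maps under composition. -/
theorem exists_idempotent_comp [T2Space Z] (s : Set (Z → Z)) (hne : s.Nonempty)
    (hs : IsCompact s) (hcomp : ∀ g ∈ s, ∀ h ∈ s, g ∘ h ∈ s) : ∃ u ∈ s, u ∘ u = u := by
  let : Semigroup (Z → Z) := { mul := fun g h => g ∘ h, mul_assoc := fun _ _ _ => rfl }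
  exact exists_idempotent_in_compact_subsemigroup
    (fun r => continuous_pi fun z => continuous_apply (r z)) s hne hs hcomp

/-- The enveloping (Ellis) semigroup: the pointwise closure of the iterates. -/
def envelopingSemigroup (f : Z → Z) : Set (Z → Z) :=
  closure (Set.range fun n : ℕ => f^[n])

theorem iterate_comp_mem_envelopingSemigroup (hf : Continuous f) (n : ℕ) {g : Z → Z}
    (hg : g ∈ envelopingSemigroup f) : f^[n] ∘ g ∈ envelopingSemigroup f := by
  have hc : Continuous fun g : Z → Z => f^[n] ∘ g :=
    continuous_pi fun z => (hf.iterate n).comp (continuous_apply z)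
  refine map_mem_closure hc hg ?_
  rintro _ ⟨m, rfl⟩
  exact ⟨n + m, Function.iterate_add f n m⟩

/-- Only `g ↦ g ∘ h` is continuous for arbitrary `h`, so the closure is taken first on the right
with iterates on the left, then on the left. -/
theorem comp_mem_envelopingSemigroup (hf : Continuous f) {g h : Z → Z}
    (hg : g ∈ envelopingSemigroup f) (hh : h ∈ envelopingSemigroup f) :
    g ∘ h ∈ envelopingSemigroup f := by
  have hc : Continuous fun g : Z → Z => g ∘ h := continuous_pi fun z => continuous_apply (h z)
  refine closure_minimal ?_ (isClosed_closure.preimage hc) hg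
  rintro _ ⟨m, rfl⟩
  exact iterate_comp_mem_envelopingSemigroup hf m hh

theorem mapsTo_of_mem_envelopingSemigroup {M : Set Z} (hM : IsClosed M)
    (hinv : Set.MapsTo f M M) {g : Z → Z} (hg : g ∈ envelopingSemigroup f) : Set.MapsTo g M M := by
  intro z hz
  refine closure_minimal ?_ (hM.preimage (continuous_apply z)) hg
  rintro _ ⟨n, rfl⟩
  exact hinv.iterate n hz

theorem exists_mem_envelopingSemigroup_apply_eq [CompactSpace Z] [T2Space Z] {z w : Z}
    (hw : w ∈ closure (orbit f z)) : ∃ g ∈ envelopingSemigroup f, g z = w := by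
  have hK : IsCompact ((fun g : Z → Z => g z) '' envelopingSemigroup f) :=
    (isClosed_closure.isCompact).image (continuous_apply z)
  refine closure_minimal ?_ hK.isClosed hw
  rintro _ ⟨n, rfl⟩
  exact ⟨f^[n], subset_closure ⟨n, rfl⟩, rfl⟩

theorem mapsTo_closure_orbit (hf : Continuous f) (z : Z) :
    Set.MapsTo f (closure (orbit f z)) (closure (orbit f z)) := by
  refine Set.MapsTo.closure ?_ hf
  rintro _ ⟨n, rfl⟩
  exact ⟨n + 1, Function.iterate_succ_apply' f n z⟩

theorem closure_orbit_subset {M : Set Z} (hM : IsClosed M) (hinv : Set.MapsTo f M M) {z : Z}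
    (hz : z ∈ M) : closure (orbit f z) ⊆ M := by
  refine closure_minimal ?_ hM
  rintro _ ⟨n, rfl⟩
  exact hinv.iterate n hz

/-- Every non-empty closed invariant set of a compact system contains a minimal one. -/
theorem exists_minimal_invariant_subset [CompactSpace Z] {K : Set Z} (hK : IsClosed K)
    (hne : K.Nonempty) (hinv : Set.MapsTo f K K) :
    ∃ M ⊆ K, Minimal (fun M : Set Z => IsClosed M ∧ M.Nonempty ∧ Set.MapsTo f M M) M := by
  refine zorn_superset_nonempty {M : Set Z | IsClosed M ∧ M.Nonempty ∧ Set.MapsTo f M M} ?_ K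
    ⟨hK, hne, hinv⟩
  intro c hcs hc hcne
  refine ⟨⋂₀ c, ⟨isClosed_sInter fun t ht => (hcs ht).1, ?_, ?_⟩,
    fun s hs => Set.sInter_subset_of_mem hs⟩
  · have := hcne.coe_sort
    rw [Set.sInter_eq_iInter]
    exact IsCompact.nonempty_iInter_of_directed_nonempty_isCompact_isClosed _
      (DirectedOn.directed_val (IsChain.directedOn hc.symm)) (fun i => (hcs i.prop).2.1)
      (fun i => (hcs i.prop).1.isCompact) (fun i => (hcs i.prop).1)
  · exact fun z hz t ht => (hcs ht).2.2 (hz t ht)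

/-- Points of a minimal set return to each of their neighbourhoods with bounded gaps. -/
theorem exists_syndetic_return [CompactSpace Z] (hf : Continuous f) {M : Set Z}
    (hM : Minimal (fun M : Set Z => IsClosed M ∧ M.Nonempty ∧ Set.MapsTo f M M) M)
    {z : Z} (hz : z ∈ M) {W : Set Z} (hW : IsOpen W) (hzW : z ∈ W) :
    ∃ L : ℕ, ∀ a : ℕ, ∃ n ≤ L, f^[n + a] z ∈ W := by
  have hvisit : M ⊆ ⋃ n : ℕ, f^[n] ⁻¹' W := by
    intro w hw
    have hsub := closure_orbit_subset hM.prop.1 hM.prop.2.2 hw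
    have hzw : z ∈ closure (orbit f w) :=
      hM.le_of_le ⟨isClosed_closure, ⟨w, subset_closure (Set.mem_range_self 0)⟩, mapsTo_closure_orbit hf w⟩
        hsub hz
    obtain ⟨_, hv, n, rfl⟩ := mem_closure_iff.1 hzw W hW hzW
    exact Set.mem_iUnion.2 ⟨n, hv⟩
  obtain ⟨t, ht⟩ := hM.prop.1.isCompact.elim_finite_subcover _
    (fun n => hW.preimage (hf.iterate n)) hvisit
  refine ⟨t.sup id, fun a => ?_⟩
  obtain ⟨n, hn, hnW⟩ := Set.mem_iUnion₂.1 (ht (hM.prop.2.2.iterate a hz))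
  refine ⟨n, Finset.le_sup (f := id) hn, ?_⟩
  rwa [Function.iterate_add_apply]

end EnvelopingSemigroup

/-! ### Distal points and product minimality -/

section Distal

variable {A : Type*} [MetricSpace A] {f : A → A}

theorem isProximalPair_of_forall_exists [CompactSpace A] {x y : A}
    (h : ∀ ε > 0, ∃ n : ℕ, dist (f^[n] x) (f^[n] y) < ε) : IsProximalPair f x y := by
  have hfreq : ∀ ε > 0, ∃ᶠ n : ℕ in atTop, dist (f^[n] x) (f^[n] y) < ε := by
    intro ε hε
    rw [frequently_atTop]
    intro N
    -- Orbits that meet stay together; otherwise the first `N` distances have a positive lower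
    -- bound, which forces a close time past `N`.
    by_cases hN : ∃ n, f^[n] x = f^[n] y
    · obtain ⟨n, hn⟩ := hN
      refine ⟨N + n, Nat.le_add_right _ _, ?_⟩
      rw [Function.iterate_add_apply, Function.iterate_add_apply, hn, dist_self]
      exact hε
    · push Not at hN
      obtain ⟨δ, hδ, hδN⟩ : ∃ δ > 0, ∀ n < N, δ ≤ dist (f^[n] x) (f^[n] y) := by
        clear h
        induction N with
        | zero => exact ⟨1, one_pos, by simp⟩
        | succ N ih =>
          obtain ⟨δ, hδ, h⟩ := ih
          refine ⟨min δ (dist (f^[N] x) (f^[N] y)), lt_min hδ (dist_pos.2 (hN N)), fun n hn => ?_⟩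
          rcases Nat.lt_succ_iff_lt_or_eq.1 hn with hn | rfl
          · exact (min_le_left _ _).trans (h n hn)
          · exact min_le_right _ _
      obtain ⟨n, hn⟩ := h (min ε δ) (lt_min hε hδ)
      refine ⟨n, ?_, hn.trans_le (min_le_left _ _)⟩
      by_contra! hlt
      exact absurd (hδN n hlt) (not_le.2 (hn.trans_le (min_le_right _ _)))
  have hbelow : IsBoundedUnder (· ≥ ·) atTop fun n : ℕ => dist (f^[n] x) (f^[n] y) :=
    isBoundedUnder_of ⟨0, fun _ => dist_nonneg⟩
  have hcobdd : IsCoboundedUnder (· ≥ ·) atTop fun n : ℕ => dist (f^[n] x) (f^[n] y) :=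
    IsBoundedUnder.isCoboundedUnder_ge (isBoundedUnder_of ⟨Metric.diam (Set.univ : Set A),
      fun _ => Metric.dist_le_diam_of_mem isCompact_univ.isBounded trivial trivial⟩)
  refine le_antisymm (le_of_forall_pos_le_add fun ε hε => ?_)
    (le_liminf_of_le hcobdd (Eventually.of_forall fun _ => dist_nonneg))
  rw [zero_add]
  exact liminf_le_of_frequently_le ((hfreq ε hε).mono fun _ h => h.le) hbelow

/-- The pair formed by a distal point and a point of a minimal system lies in a minimal set of the
product system. -/
theorem IsDistalPoint.exists_minimal_mem [CompactSpace A] (hf : Continuous f) {a : A}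
    (ha : IsDistalPoint f a) {Y : Type*} [MetricSpace Y] [CompactSpace Y] {S : Y → Y}
    (hS : Continuous S) (hmin : IsMinimal S) (y : Y) :
    ∃ M : Set (A × Y), Minimal (fun M : Set (A × Y) => IsClosed M ∧ M.Nonempty ∧
      Set.MapsTo (Prod.map f S) M M) M ∧ (a, y) ∈ M := by
  set F : A × Y → A × Y := Prod.map f S with hFdef
  have hF : Continuous F := hf.prodMap hS
  have hFfst : ∀ n p, (F^[n] p).1 = f^[n] p.1 := fun n p => by rw [hFdef, Prod.map_iterate]; rfl
  have hFsnd : ∀ n p, (F^[n] p).2 = S^[n] p.2 := fun n p => by rw [hFdef, Prod.map_iterate]; rfl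
  have hsnd : ∀ g ∈ envelopingSemigroup F, ∀ p q : A × Y, p.2 = q.2 → (g p).2 = (g q).2 := by
    intro g hg p q hpq
    refine closure_minimal ?_ (isClosed_eq (continuous_snd.comp (continuous_apply p))
      (continuous_snd.comp (continuous_apply q))) hg
    rintro _ ⟨n, rfl⟩
    simp only [Set.mem_ofPred_eq, Function.comp_apply, hFsnd, hpq]
  obtain ⟨M, hMsub, hM⟩ := exists_minimal_invariant_subset (f := F) isClosed_closure
    ⟨(a, y), subset_closure (Set.mem_range_self 0)⟩ (mapsTo_closure_orbit hF (a, y))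
  obtain ⟨b, hb⟩ : ∃ b, (b, y) ∈ M := by
    have hcl : IsClosed (Prod.snd '' M) := (hM.prop.1.isCompact.image continuous_snd).isClosed
    obtain ⟨p, hp⟩ := hM.prop.2.1
    have hsub : closure (orbit S p.2) ⊆ Prod.snd '' M := by
      refine closure_orbit_subset hcl ?_ ⟨p, hp, rfl⟩
      rintro _ ⟨q, hq, rfl⟩
      exact ⟨F q, hM.prop.2.2 hq, rfl⟩
    obtain ⟨⟨b, y'⟩, hb, rfl⟩ := hsub (hmin p.2 y)
    exact ⟨b, hb⟩
  -- A compact semigroup. Its idempotent `u` gives `(a, y)` and `u (a, y)` the same image, so their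
  -- first coordinates are proximal, and distality yields `u (a, y) = (a, y)`.
  let s : Set (A × Y → A × Y) :=
    envelopingSemigroup F ∩ ({g | g (a, y) ∈ M} ∩ {g | (g (a, y)).2 = y})
  have hsclosed : IsClosed s := isClosed_closure.inter
    ((hM.prop.1.preimage (continuous_apply (a, y))).inter
      (isClosed_eq (continuous_snd.comp (continuous_apply (a, y))) continuous_const))
  have hsne : s.Nonempty := by
    obtain ⟨g, hg, hgb⟩ := exists_mem_envelopingSemigroup_apply_eq (hMsub hb)
    exact ⟨g, hg, by simp [hgb, hb], by simp [hgb]⟩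
  have hscomp : ∀ g ∈ s, ∀ h ∈ s, g ∘ h ∈ s := by
    rintro g ⟨hgE, hgM, hgy⟩ h ⟨hhE, hhM, hhy⟩
    refine ⟨comp_mem_envelopingSemigroup hF hgE hhE,
      mapsTo_of_mem_envelopingSemigroup hM.prop.1 hM.prop.2.2 hgE hhM, ?_⟩
    exact (hsnd g hgE _ (a, y) hhy).trans hgy
  obtain ⟨u, ⟨huE, huM, huy⟩, hu⟩ := exists_idempotent_comp s hsne hsclosed.isCompact hscomp
  have h1 : (u (a, y)).1 = a := by
    refine (ha _ ?_ (isProximalPair_of_forall_exists fun ε hε => ?_)).symm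
    · refine map_mem_closure continuous_fst (hMsub huM) ?_
      rintro _ ⟨n, rfl⟩
      exact ⟨n, (hFfst n (a, y)).symm⟩
    · have hopen : IsOpen {g : A × Y → A × Y | dist (g (a, y)).1 (g (u (a, y))).1 < ε} :=
        isOpen_lt ((continuous_fst.comp (continuous_apply _)).dist
          (continuous_fst.comp (continuous_apply _))) continuous_const
      have hmem : u ∈ {g : A × Y → A × Y | dist (g (a, y)).1 (g (u (a, y))).1 < ε} := by
        have : u (u (a, y)) = u (a, y) := congrFun hu (a, y)
        simp only [Set.mem_ofPred_eq, this, dist_self, hε]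
      obtain ⟨_, hn, n, rfl⟩ := mem_closure_iff.1 huE _ hopen hmem
      exact ⟨n, by simpa only [Set.mem_ofPred_eq, hFfst] using hn⟩
  exact ⟨M, hM, (Prod.ext h1 huy : u (a, y) = (a, y)) ▸ huM⟩

end Distal

/-! ### A universal point from dense distal sets -/

section Hyperspace

variable {X : Type*} [MetricSpace X] {T : X → X}

theorem coe_iterate_hyperMap (hT : Continuous T) (n : ℕ) (C : NonemptyCompacts X) :
    (((hyperMap T hT)^[n] C : NonemptyCompacts X) : Set X) = T^[n] '' C := by
  induction n with
  | zero => simp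
  | succ n ih =>
    rw [Function.iterate_succ_apply', Function.iterate_succ', Set.image_comp, ← ih]
    exact NonemptyCompacts.coe_map hT _

theorem continuous_hyperMap (hT : Continuous T) : Continuous (hyperMap T hT) :=
  hT.nonemptyCompacts_map

/-- In a weakly mixing system with dense distal sets, there is a point `x₀` such that for every
point `y` of every minimal system the orbit closure of `(x₀, y)` contains the fibre over `y`. -/
theorem exists_forall_mem_closure_orbit [CompactSpace X] [Nonempty X] (hT : Continuous T)
    (hmix : IsWeaklyMixing T) (hdist : HasDenseDistalSets T hT) :
    ∃ x₀ : X, ∀ {Y : Type*} [MetricSpace Y] [CompactSpace Y] (S : Y → Y), Continuous S →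
      IsMinimal S → ∀ (x : X) (y : Y), (x, y) ∈ closure (orbit (Prod.map T S) (x₀, y)) := by
  have hex : ∀ B : countableBasis X, ∃ C : NonemptyCompacts X,
      IsDistalPoint (hyperMap T hT) C ∧ (C : Set X) ⊆ B := fun B =>
    hdist B (isOpen_of_mem_countableBasis B.2) (nonempty_of_mem_countableBasis B.2)
  choose C hC hCB using hex
  choose c hc using fun B => (C B).nonempty
  have : Countable (countableBasis X) := (countable_countableBasis X).to_subtype
  obtain ⟨x₀, hx₀⟩ := (dense_iInter_of_isOpen
    (f := fun i : countableBasis X × ℕ × ℕ => shadowing T (c i.1) i.2.1 (1 / (i.2.2 + 1 : ℝ)))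
    (fun i => isOpen_shadowing hT _ _ _)
    (fun i => hmix.dense_shadowing hT _ _ Nat.one_div_pos_of_nat)).nonempty
  refine ⟨x₀, fun {Y} _ _ S hS hmin x y => ?_⟩
  rw [Metric.mem_closure_iff]
  intro ε hε
  obtain ⟨B, hB, hxB, hBε⟩ := (isBasis_countableBasis X).exists_subset_of_mem_open
    (Metric.mem_ball_self (x := x) (half_pos hε)) Metric.isOpen_ball
  -- Budget: `ε / 4` for shadowing, `ε / 4` for the Hausdorff return, `ε / 2` for the ball around
  -- `x`.
  obtain ⟨m, hm⟩ := exists_nat_one_div_lt (show 0 < ε / 4 by linarith)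
  obtain ⟨M, hM, hyM⟩ := (hC ⟨B, hB⟩).exists_minimal_mem (continuous_hyperMap hT) hS hmin y
  obtain ⟨L, hL⟩ := exists_syndetic_return ((continuous_hyperMap hT).prodMap hS) hM hyM
    Metric.isOpen_ball (Metric.mem_ball_self (show 0 < ε / 4 by linarith))
  -- `L` depends on `y`, but `x₀` shadows for all `L`.
  obtain ⟨a, ha⟩ := Set.mem_iUnion.1 (Set.mem_iInter.1 hx₀ (⟨B, hB⟩, L, m))
  obtain ⟨n, hnL, hn⟩ := hL a
  have hxc : dist (T^[n + a] x₀) (T^[n + a] (c ⟨B, hB⟩)) < 1 / (m + 1 : ℝ) :=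
    Set.mem_iInter₂.1 ha n (Finset.mem_range.2 (Nat.lt_succ_of_le hnL))
  rw [Prod.map_iterate, Metric.mem_ball, Prod.dist_eq, max_lt_iff] at hn
  obtain ⟨hn1, hn2⟩ := hn
  simp only [Prod.map_fst, Prod.map_snd] at hn1 hn2
  rw [Metric.NonemptyCompacts.dist_eq, coe_iterate_hyperMap] at hn1
  obtain ⟨d, hd, hcd⟩ := Metric.exists_dist_lt_of_hausdorffDist_lt
    (Set.mem_image_of_mem T^[n + a] (hc ⟨B, hB⟩)) hn1
    (Metric.hausdorffEDist_ne_top_of_nonempty_of_bounded ((C ⟨B, hB⟩).nonempty.image _)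
      (C ⟨B, hB⟩).nonempty ((C ⟨B, hB⟩).isCompact.image (hT.iterate _)).isBounded
      (C ⟨B, hB⟩).isCompact.isBounded)
  have hdx : dist d x < ε / 2 := hBε (hCB ⟨B, hB⟩ hd)
  refine ⟨_, ⟨n + a, rfl⟩, ?_⟩
  rw [dist_comm]
  simp only [Prod.map_iterate, Prod.map_apply, Prod.dist_eq, max_lt_iff]
  refine ⟨?_, by linarith⟩
  have h1 := dist_triangle4 (T^[n + a] x₀) (T^[n + a] (c ⟨B, hB⟩)) d x
  linarith

end Hyperspace

end TopDyn

theorem theorem5p5 {X : Type*} [MetricSpace X] [CompactSpace X]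
    (T : X → X) (hT : Continuous T) (hTsurj : Function.Surjective T)
    (hmix : TopDyn.IsWeaklyMixing T) (hdist : TopDyn.HasDenseDistalSets T hT)
    {Y : Type*} [MetricSpace Y] [CompactSpace Y]
    (S : Y → Y) (hS : Continuous S) (hSsurj : Function.Surjective S)
    (hmin : TopDyn.IsMinimal S) :
    TopDyn.AreDisjoint T S := by
  intro J hJ
  have hinv : Set.MapsTo (Prod.map T S) J J := fun p hp => hJ.invariant ⟨p, hp, rfl⟩
  have : Nonempty X := ⟨hJ.nonempty.some.1⟩
  obtain ⟨x₀, hx₀⟩ := TopDyn.exists_forall_mem_closure_orbit hT hmix hdist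
  obtain ⟨⟨_, y⟩, hy, rfl⟩ : x₀ ∈ Prod.fst '' J := hJ.fst_image ▸ Set.mem_univ x₀
  have hfibre : ∀ x, (x, y) ∈ J := fun x =>
    TopDyn.closure_orbit_subset hJ.isClosed hinv hy (hx₀ S hS hmin x y)
  refine Set.eq_univ_of_forall fun ⟨x, y'⟩ => ?_
  have hsub : closure (TopDyn.orbit S y) ⊆ {z | (x, z) ∈ J} := by
    refine closure_minimal ?_ (hJ.isClosed.preimage (Continuous.prodMk_right x))
    rintro _ ⟨n, rfl⟩
    -- Surjectivity carries the full fibre over `y` onto the full fibre over `S^[n] y`.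
    obtain ⟨w, rfl⟩ := hTsurj.iterate n x
    have := hinv.iterate n (hfibre w)
    rwa [Prod.map_iterate] at this
  exact hsub (hmin y y')
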